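/- Let $k$ be a field. A Poisson algebra over $k$ is a $k$-vector space $P$ with a commutative associative (not necessarily unital) $k$-algebra structure and a $k$-Lie algebra structure $[-,-]$ such that $[x,yz]=[x,y]z+y[x,z]$ for all $x,y,z\in P$; a Poisson algebra map is a linear map compatible with products and brackets. For a commutative unital $k$-algebra $A$, $P\otimes A$ is the Poisson algebra with $(x\otimes a)(y\otimes b)=xy\otimes ab$ and $[x\otimes a,y\otimes b]=[x,y]\otimes ab$. A commutative bialgebra (in particular, a commutative Hopf algebra) $H$ coacts on $P$ via $\rho$ if $\rho:P\to P\otimes H$ is a Poisson algebra map that is also a right $H$-comodule structure. Let $\mathrm{CoactHopf}_P$ be the category whose objects are the pairs $(H,\rho)$ with $H$ a commutative Hopf algebra coacting on $P$ via $\rho$, and whose morphisms $(H,\rho)\to(H',\rho')$ are the bialgebra maps $f:H\to H'$ with $(\mathrm{Id}_P\otimes f)\circ\rho=\rho'$. Let $P$ be a finite dimensional Poisson algebra. Then $\mathrm{CoactHopf}_P$ has an initial object. It is obtained as follows. Let $e_1,\dots,e_n$ be any basis of $P$, with structure constants $e_ie_j=\sum_{u}\tau_{i,j}^u e_u$ and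 $[e_i,e_j]=\sum_u\mu_{i,j}^u e_u$. Let $\mathcal P(P)$ be the commutative $k$-algebra generated by $x_{si}$, $1\le s,i\le n$, subject to the relations $$\sum_{u}\tau_{i,j}^u x_{au}=\sum_{s,t}\tau_{s,t}^a x_{si}x_{tj},\qquad \sum_{u}\mu_{i,j}^u x_{au}=\sum_{s,t}\mu_{s,t}^a x_{si}x_{tj}\qquad(1\le a,i,j\le n),$$ which is a bialgebra with $\Delta(x_{ij})=\sum_s x_{is}\otimes x_{sj}$ and $\varepsilon(x_{ij})=\delta_{i,j}$, and let $\eta:P\to P\otimes\mathcal P(P)$ be the linear map $\eta(e_i)=\sum_s e_s\otimes x_{si}$. A commutative Hopf envelope of a commutative bialgebra $B$ is a commutative Hopf algebra $L$ with a bialgebra map $\mu:B\to L$ such that every bialgebra map from $B$ to a commutative Hopf algebra $A$ factors as $f\circ\mu$ for a unique bialgebra map $f:L\to A$. Then $\mathcal P(P)$ has a commutative Hopf envelope, and for every commutative Hopf envelope $(\mathcal H(P),\mu)$ of $\mathcal P(P)$ the map $\lambda_P:=(\mathrm{Id}_P\otimes\mu)\circ\eta$ is a coaction of $\mathcal H(P)$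 on $P$ and $(\mathcal H(P),\lambda_P)$ is an initial object of $\mathrm{CoactHopf}_P$. -/

import Mathlib

open scoped TensorProduct

universe u v

/-- A Poisson algebra over the field `k`: a commutative associative (not necessarily unital)
`k`-algebra `P` with a `k`-bilinear Lie bracket which is a derivation in each variable. -/
class PoissonAlgebra (k : Type*) (P : Type*) [Field k] [NonUnitalCommRing P] [Module k P]
    [IsScalarTower k P P] [SMulCommClass k P P] where
  /-- The Lie bracket `[x, y]`, as a bilinear map. -/
  bracket (k) : P →ₗ[k] P →ₗ[k] P
  bracket_self : ∀ x : P, bracket x x = 0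
  jacobi : ∀ x y z : P,
    bracket x (bracket y z) + bracket y (bracket z x) + bracket z (bracket x y) = 0
  leibniz : ∀ x y z : P, bracket x (y * z) = bracket x y * z + y * bracket x z

namespace PoissonAlgebra

section Tensor

variable {k P A : Type*} [Field k] [NonUnitalCommRing P] [Module k P]
  [IsScalarTower k P P] [SMulCommClass k P P] [CommRing A] [Algebra k A]

/-- For `A` a commutative algebra, `P ⊗ A` is a commutative associative algebra with
`(x ⊗ a) (y ⊗ b) = xy ⊗ ab`. -/
noncomputable instance instNonUnitalCommRingTensor : NonUnitalCommRing (P ⊗[k] A) where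
  __ := (inferInstance : NonUnitalRing (P ⊗[k] A))
  mul_comm x y := by
    induction x with
    | zero => simp
    | add x₁ x₂ h₁ h₂ => rw [add_mul, mul_add, h₁, h₂]
    | tmul p a =>
      induction y with
      | zero => simp
      | add y₁ y₂ h₁ h₂ => rw [add_mul, mul_add, h₁, h₂]
      | tmul q c => simp [mul_comm]

variable [PoissonAlgebra k P]

theorem bracket_swap (x y : P) : bracket k x y = -bracket k y x := by
  have h := bracket_self (k := k) (x + y)
  simp only [map_add, LinearMap.add_apply, bracket_self, zero_add, add_zero] at h
  exact eq_neg_of_add_eq_zero_right h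

variable (k P A) in
/-- The bracket of `P ⊗ A`: `[x ⊗ a, y ⊗ b] = [x, y] ⊗ ab`. -/
noncomputable def tensorBracket : (P ⊗[k] A) →ₗ[k] (P ⊗[k] A) →ₗ[k] (P ⊗[k] A) :=
  TensorProduct.map₂ (bracket k) (LinearMap.mul k A)

@[simp]
theorem tensorBracket_tmul (x y : P) (a c : A) :
    tensorBracket k P A (x ⊗ₜ a) (y ⊗ₜ c) = bracket k x y ⊗ₜ (a * c) := by
  simp [tensorBracket]

theorem tensorBracket_swap (X Y : P ⊗[k] A) :
    tensorBracket k P A X Y = -tensorBracket k P A Y X := by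
  induction X with
  | zero => simp
  | add x₁ x₂ h₁ h₂ => rw [map_add, LinearMap.add_apply, map_add, h₁, h₂, neg_add]
  | tmul p a =>
    induction Y with
    | zero => simp
    | add y₁ y₂ h₁ h₂ => rw [map_add, map_add, LinearMap.add_apply, h₁, h₂, neg_add]
    | tmul q c =>
      rw [tensorBracket_tmul, tensorBracket_tmul, bracket_swap (k := k) p q, mul_comm a c,
        TensorProduct.neg_tmul]

/-- For a Poisson algebra `P` and a commutative algebra `A`, the Poisson algebra `P ⊗ A`. -/
noncomputable instance instTensor : PoissonAlgebra k (P ⊗[k] A) where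
  bracket := tensorBracket k P A
  bracket_self X := by
    induction X with
    | zero => simp
    | tmul p a => simp [bracket_self]
    | add x y hx hy =>
      simp only [map_add, LinearMap.add_apply, hx, hy, zero_add, add_zero]
      rw [tensorBracket_swap x y, add_neg_cancel]
  jacobi X Y Z := by
    induction X with
    | zero => simp
    | add x₁ x₂ h₁ h₂ =>
      simp only [map_add, LinearMap.add_apply] at h₁ h₂ ⊢
      refine Eq.trans ?_ ((congrArg₂ (· + ·) h₁ h₂).trans (add_zero 0))
      abel
    | tmul p a =>
      induction Y with
      | zero => simp
      | add x₁ x₂ h₁ h₂ =>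
        simp only [map_add, LinearMap.add_apply] at h₁ h₂ ⊢
        refine Eq.trans ?_ ((congrArg₂ (· + ·) h₁ h₂).trans (add_zero 0))
        abel
      | tmul q c =>
        induction Z with
        | zero => simp
        | add x₁ x₂ h₁ h₂ =>
          simp only [map_add, LinearMap.add_apply] at h₁ h₂ ⊢
          refine Eq.trans ?_ ((congrArg₂ (· + ·) h₁ h₂).trans (add_zero 0))
          abel
        | tmul r d =>
          simp only [tensorBracket_tmul]
          rw [show c * (d * a) = a * (c * d) by ring, show d * (a * c) = a * (c * d) by ring,
            ← TensorProduct.add_tmul, ← TensorProduct.add_tmul, jacobi, TensorProduct.zero_tmul]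
  leibniz X Y Z := by
    induction X with
    | zero => simp
    | add x₁ x₂ h₁ h₂ =>
      simp only [map_add, LinearMap.add_apply, add_mul, mul_add, h₁, h₂]
      abel
    | tmul p a =>
      induction Y with
      | zero => simp
      | add x₁ x₂ h₁ h₂ =>
        simp only [map_add, add_mul, h₁, h₂]
        abel
      | tmul q c =>
        induction Z with
        | zero => simp
        | add x₁ x₂ h₁ h₂ =>
          simp only [map_add, mul_add, h₁, h₂]
          abel
        | tmul r d =>
          simp only [tensorBracket_tmul, Algebra.TensorProduct.tmul_mul_tmul]
          rw [leibniz, TensorProduct.add_tmul, show a * c * d = a * (c * d) by ring,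
            show c * (a * d) = a * (c * d) by ring]

end Tensor

end PoissonAlgebra

/-- A linear map of Poisson algebras is a Poisson algebra map if it is compatible with products
and brackets. -/
structure IsPoissonHom {k P Q : Type*} [Field k]
    [NonUnitalCommRing P] [Module k P] [IsScalarTower k P P] [SMulCommClass k P P]
    [PoissonAlgebra k P]
    [NonUnitalCommRing Q] [Module k Q] [IsScalarTower k Q Q] [SMulCommClass k Q Q]
    [PoissonAlgebra k Q] (f : P →ₗ[k] Q) : Prop where
  map_mul : ∀ x y : P, f (x * y) = f x * f y
  map_bracket : ∀ x y : P,
    f (PoissonAlgebra.bracket k x y) = PoissonAlgebra.bracket k (f x) (f y)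

/-- `ρ : P → P ⊗ H` makes `P` a right Poisson `H`-comodule algebra: it is a Poisson algebra map
and a right `H`-comodule structure (coassociative and counital). -/
structure IsPoissonCoaction {k P H : Type*} [Field k]
    [NonUnitalCommRing P] [Module k P] [IsScalarTower k P P] [SMulCommClass k P P]
    [PoissonAlgebra k P] [CommRing H] [Bialgebra k H] (ρ : P →ₗ[k] P ⊗[k] H) : Prop
    extends IsPoissonHom ρ where
  coassoc : ∀ p : P, TensorProduct.assoc k P H H (ρ.rTensor H (ρ p)) =
    (Coalgebra.comul (R := k) (A := H)).lTensor P (ρ p)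
  counit : ∀ p : P, (Coalgebra.counit (R := k) (A := H)).lTensor P (ρ p) = p ⊗ₜ[k] (1 : k)

/-- Objects of the category of commutative Hopf algebras coacting on `P`. -/
structure CoactHopf (k : Type u) (P : Type v) [Field k]
    [NonUnitalCommRing P] [Module k P] [IsScalarTower k P P] [SMulCommClass k P P]
    [PoissonAlgebra k P] where
  /-- The underlying Hopf algebra `H`. -/
  carrier : Type u
  [commRing : CommRing carrier]
  [hopfAlgebra : HopfAlgebra k carrier]
  /-- The coaction `P → P ⊗ H`. -/
  coact : P →ₗ[k] P ⊗[k] carrier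
  isPoissonCoaction : IsPoissonCoaction coact

namespace CoactHopf

attribute [instance] CoactHopf.commRing CoactHopf.hopfAlgebra

variable {k : Type u} {P : Type v} [Field k]
  [NonUnitalCommRing P] [Module k P] [IsScalarTower k P P] [SMulCommClass k P P]
  [PoissonAlgebra k P]

/-- Morphisms `(H, ρ) → (H', ρ')`: bialgebra maps `f : H → H'` with `(id ⊗ f) ∘ ρ = ρ'`. -/
@[ext]
structure Hom (X Y : CoactHopf k P) where
  /-- The underlying bialgebra map. -/
  toBialgHom : X.carrier →ₐc[k] Y.carrier
  comm : (toBialgHom : X.carrier →ₗ[k] Y.carrier).lTensor P ∘ₗ X.coact = Y.coact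

instance : CategoryTheory.Category (CoactHopf k P) where
  Hom := Hom
  id X := ⟨.id k X.carrier, by
    have : ((BialgHom.id k X.carrier : X.carrier →ₐc[k] X.carrier) :
        X.carrier →ₗ[k] X.carrier) = LinearMap.id := rfl
    rw [this, LinearMap.lTensor_id, LinearMap.id_comp]⟩
  comp {X Y Z} f g := ⟨g.toBialgHom.comp f.toBialgHom, by
    have : ((g.toBialgHom.comp f.toBialgHom : X.carrier →ₐc[k] Z.carrier) :
        X.carrier →ₗ[k] Z.carrier) = (g.toBialgHom : Y.carrier →ₗ[k] Z.carrier) ∘ₗ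
          (f.toBialgHom : X.carrier →ₗ[k] Y.carrier) := rfl
    rw [this, LinearMap.lTensor_comp, LinearMap.comp_assoc, f.comm, g.comm]⟩

end CoactHopf

/-- `(L, μ)` is the commutative Hopf envelope of the commutative bialgebra `B`, i.e. a universal
arrow from `B` to the forgetful functor from commutative Hopf algebras to commutative
bialgebras. -/
def IsCommHopfEnvelope {k B L : Type u} [Field k] [CommRing B] [Bialgebra k B]
    [CommRing L] [HopfAlgebra k L] (μ : B →ₐc[k] L) : Prop :=
  ∀ (A : Type u) [CommRing A] [HopfAlgebra k A] (g : B →ₐc[k] A),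
    ∃! f : L →ₐc[k] A, f.comp μ = g

section UniversalCoactingBialgebra

set_option linter.unusedSectionVars false

open MvPolynomial

variable {k : Type u} {P : Type v} {n : ℕ} [Field k] [NonUnitalCommRing P] [Module k P]
  [IsScalarTower k P P] [SMulCommClass k P P] [PoissonAlgebra k P]

/-- For a bilinear operation `m` on `P` with structure constants
`m e_i e_j = ∑ u, τ i j u • e_u`, the polynomial
`∑ u, τ i j u X_{au} - ∑ s t, τ s t a X_{si} X_{tj}`. -/
noncomputable def structureRel (b : Module.Basis (Fin n) k P) (m : P →ₗ[k] P →ₗ[k] P)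
    (a i j : Fin n) : MvPolynomial (Fin n × Fin n) k :=
  (∑ r, C (b.repr (m (b i) (b j)) r) * X (a, r)) -
    ∑ s, ∑ t, C (b.repr (m (b s) (b t)) a) * (X (s, i) * X (t, j))

/-- The ideal generated by the relations for the product and for the bracket. -/
noncomputable def coactIdeal (b : Module.Basis (Fin n) k P) :
    Ideal (MvPolynomial (Fin n × Fin n) k) :=
  Ideal.span
    ({f | ∃ a i j, f = structureRel b (LinearMap.mul k P) a i j} ∪
      {f | ∃ a i j, f = structureRel b (PoissonAlgebra.bracket k) a i j})

/-- The universal coacting bialgebra `𝒫(P)` of `P`, presented through a basis of `P`: the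
polynomial algebra on `X_{si}` modulo the relations
`∑ u, τ i j u x_{au} = ∑ s t, τ s t a x_{si} x_{tj}`, where `τ` runs over the structure constants
of the product and over those of the bracket. -/
def CoactBialg (b : Module.Basis (Fin n) k P) : Type u :=
  MvPolynomial (Fin n × Fin n) k ⧸ coactIdeal b

namespace CoactBialg

noncomputable instance (b : Module.Basis (Fin n) k P) : CommRing (CoactBialg b) :=
  inferInstanceAs (CommRing (MvPolynomial (Fin n × Fin n) k ⧸ coactIdeal b))

noncomputable instance (b : Module.Basis (Fin n) k P) : Algebra k (CoactBialg b) :=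
  inferInstanceAs (Algebra k (MvPolynomial (Fin n × Fin n) k ⧸ coactIdeal b))

variable (b : Module.Basis (Fin n) k P)

/-- The quotient map. -/
noncomputable def mk : MvPolynomial (Fin n × Fin n) k →ₐ[k] CoactBialg b :=
  Ideal.Quotient.mkₐ k (coactIdeal b)

/-- The generator `x_{si}`. -/
noncomputable def gen (s i : Fin n) : CoactBialg b := mk b (X (s, i))

/-- The elements `d s i` satisfy the relations attached to the operation `m`. -/
def Satisfies {A : Type*} [CommRing A] [Algebra k A] (m : P →ₗ[k] P →ₗ[k] P)
    (d : Fin n → Fin n → A) : Prop :=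
  ∀ a i j, ∑ r, b.repr (m (b i) (b j)) r • d a r =
    ∑ s, ∑ t, b.repr (m (b s) (b t)) a • (d s i * d t j)

theorem aeval_structureRel {A : Type*} [CommRing A] [Algebra k A] (m : P →ₗ[k] P →ₗ[k] P)
    (d : Fin n → Fin n → A) (a i j : Fin n) :
    aeval (fun q : Fin n × Fin n => d q.1 q.2) (structureRel b m a i j) =
      ∑ r, b.repr (m (b i) (b j)) r • d a r -
        ∑ s, ∑ t, b.repr (m (b s) (b t)) a • (d s i * d t j) := by
  simp [structureRel, Algebra.smul_def]

/-- The algebra map out of the quotient which is given by elements satisfying the relations. -/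
noncomputable def lift {A : Type*} [CommRing A] [Algebra k A] (d : Fin n → Fin n → A)
    (h₁ : Satisfies b (LinearMap.mul k P) d)
    (h₂ : Satisfies b (PoissonAlgebra.bracket k) d) : CoactBialg b →ₐ[k] A :=
  Ideal.Quotient.liftₐ (coactIdeal b) (aeval fun q : Fin n × Fin n => d q.1 q.2) (by
    intro f hf
    have : coactIdeal b ≤ RingHom.ker (aeval (R := k) fun q : Fin n × Fin n => d q.1 q.2) := by
      refine Ideal.span_le.2 ?_
      rintro _ (⟨a, i, j, rfl⟩ | ⟨a, i, j, rfl⟩)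
      · simp only [SetLike.mem_coe, RingHom.mem_ker]
        rw [aeval_structureRel, h₁ a i j, sub_self]
      · simp only [SetLike.mem_coe, RingHom.mem_ker]
        rw [aeval_structureRel, h₂ a i j, sub_self]
    exact this hf)

@[simp]
theorem lift_gen {A : Type*} [CommRing A] [Algebra k A] (d : Fin n → Fin n → A)
    (h₁ : Satisfies b (LinearMap.mul k P) d)
    (h₂ : Satisfies b (PoissonAlgebra.bracket k) d) (s i : Fin n) :
    lift b d h₁ h₂ (gen b s i) = d s i := by
  change aeval (fun q : Fin n × Fin n => d q.1 q.2) (X (s, i) : MvPolynomial _ k) = d s i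
  simp

theorem algHom_ext {A : Type*} [CommRing A] [Algebra k A] {f g : CoactBialg b →ₐ[k] A}
    (h : ∀ s i, f (gen b s i) = g (gen b s i)) : f = g := by
  have : f.comp (mk b) = g.comp (mk b) := MvPolynomial.algHom_ext fun q => h q.1 q.2
  ext x
  obtain ⟨y, rfl⟩ := Ideal.Quotient.mk_surjective x
  exact DFunLike.congr_fun this y

theorem satisfies_gen (m : P →ₗ[k] P →ₗ[k] P)
    (h : ∀ a i j, structureRel b m a i j ∈ coactIdeal b) : Satisfies b m (gen b) := by
  intro a i j
  have h₀ : mk b (structureRel b m a i j) = 0 := Ideal.Quotient.eq_zero_iff_mem.2 (h a i j)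
  have h₁ : mk b = aeval (R := k) fun q : Fin n × Fin n => gen b q.1 q.2 := by
    ext q
    simp [gen]
  rw [h₁, aeval_structureRel] at h₀
  exact sub_eq_zero.1 h₀

theorem satisfies_mul : Satisfies b (LinearMap.mul k P) (gen b) :=
  satisfies_gen b _ fun a i j => Ideal.subset_span (Or.inl ⟨a, i, j, rfl⟩)

theorem satisfies_bracket : Satisfies b (PoissonAlgebra.bracket k) (gen b) :=
  satisfies_gen b _ fun a i j => Ideal.subset_span (Or.inr ⟨a, i, j, rfl⟩)

theorem satisfies_comul (m : P →ₗ[k] P →ₗ[k] P) (h : Satisfies b m (gen b)) :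
    Satisfies b m fun i j => ∑ s, gen b i s ⊗ₜ[k] gen b s j := by
  intro a i j
  calc ∑ r, b.repr (m (b i) (b j)) r • ∑ s, gen b a s ⊗ₜ[k] gen b s r
      = ∑ s, gen b a s ⊗ₜ[k] ∑ r, b.repr (m (b i) (b j)) r • gen b s r := by
        simp_rw [Finset.smul_sum, TensorProduct.tmul_sum, TensorProduct.tmul_smul]
        exact Finset.sum_comm
    _ = ∑ p, ∑ q, (∑ s, b.repr (m (b p) (b q)) s • gen b a s) ⊗ₜ[k]
          (gen b p i * gen b q j) := by
        simp_rw [h _ i j, TensorProduct.tmul_sum, TensorProduct.sum_tmul,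
          TensorProduct.tmul_smul, TensorProduct.smul_tmul']
        rw [Finset.sum_comm]
        refine Finset.sum_congr rfl fun p _ => ?_
        exact Finset.sum_comm
    _ = ∑ p, ∑ q, ∑ s, ∑ t, b.repr (m (b s) (b t)) a •
          ((gen b s p * gen b t q) ⊗ₜ[k] (gen b p i * gen b q j)) := by
        simp_rw [h a, TensorProduct.sum_tmul, TensorProduct.smul_tmul']
    _ = ∑ s, ∑ t, ∑ p, ∑ q, b.repr (m (b s) (b t)) a •
          ((gen b s p * gen b t q) ⊗ₜ[k] (gen b p i * gen b q j)) := by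
        simp_rw [← Finset.sum_product']
        exact Finset.sum_bij' (fun x _ => (x.2.2.1, x.2.2.2, x.1, x.2.1))
          (fun x _ => (x.2.2.1, x.2.2.2, x.1, x.2.1)) (by simp) (by simp) (by simp) (by simp)
          (by simp)
    _ = ∑ s, ∑ t, b.repr (m (b s) (b t)) a •
          ((∑ p, gen b s p ⊗ₜ[k] gen b p i) * ∑ q, gen b t q ⊗ₜ[k] gen b q j) := by
        simp_rw [Finset.sum_mul_sum, Algebra.TensorProduct.tmul_mul_tmul, Finset.smul_sum]

theorem satisfies_counit (m : P →ₗ[k] P →ₗ[k] P) :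
    Satisfies b m fun i j => if i = j then (1 : k) else 0 := by
  intro a i j
  simp

/-- The bialgebra structure with `Δ x_{ij} = ∑ s, x_{is} ⊗ x_{sj}` and `ε x_{ij} = δ_{ij}`. -/
noncomputable instance : Bialgebra k (CoactBialg b) :=
  Bialgebra.ofAlgHom
    (lift b (fun i j => ∑ s, gen b i s ⊗ₜ[k] gen b s j)
      (satisfies_comul b _ (satisfies_mul b)) (satisfies_comul b _ (satisfies_bracket b)))
    (lift b (fun i j => if i = j then (1 : k) else 0)
      (satisfies_counit b _) (satisfies_counit b _))
    (by
      refine algHom_ext b fun s i => ?_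
      simp [TensorProduct.sum_tmul, TensorProduct.tmul_sum]
      exact Finset.sum_comm)
    (by
      refine algHom_ext b fun s i => ?_
      simp [TensorProduct.ite_tmul])
    (by
      refine algHom_ext b fun s i => ?_
      simp [TensorProduct.tmul_ite])

theorem comul_gen (i j : Fin n) : Coalgebra.comul (R := k) (gen b i j) =
    ∑ s, gen b i s ⊗ₜ[k] gen b s j :=
  lift_gen b (fun i j => ∑ s, gen b i s ⊗ₜ[k] gen b s j)
    (satisfies_comul b _ (satisfies_mul b)) (satisfies_comul b _ (satisfies_bracket b)) i j

theorem counit_gen (i j : Fin n) : Coalgebra.counit (R := k) (gen b i j) =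
    if i = j then (1 : k) else 0 :=
  lift_gen b (fun i j => if i = j then (1 : k) else 0)
    (satisfies_counit b _) (satisfies_counit b _) i j

/-- The canonical coaction `η : P → P ⊗ 𝒫(P)`, `η e_i = ∑ s, e_s ⊗ x_{si}`. -/
noncomputable def coact : P →ₗ[k] P ⊗[k] CoactBialg b :=
  b.constr k fun i => ∑ s, b s ⊗ₜ[k] gen b s i

end CoactBialg

end UniversalCoactingBialgebra

/-! Once a basis is fixed, a linear map `P → P ⊗ A` is the same as an `n × n` matrix `d` over `A`
(`ofMatrix`). It is a Poisson map exactly when `d` satisfies the defining relations of `𝒫(P)`. It is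
a comodule structure exactly when `Δ d_{ij} = ∑ s, d_{is} ⊗ d_{sj}` and `ε d_{ij} = δ_{ij}`
(`isPoissonCoaction_ofMatrix_iff`). Hence coactions of a commutative bialgebra `H` on `P` correspond
to bialgebra maps `𝒫(P) → H`. If `H` is a Hopf algebra, such a map extends uniquely along any Hopf
envelope, and this is initiality.

It remains to construct an envelope. Under a bialgebra map to a Hopf algebra the matrix of
generators becomes invertible, the antipode supplying its inverse (`isUnit_map_gen`), so the map
factors through the localization of `𝒫(P)` at the determinant of that matrix. This localization is
itself a Hopf algebra: the antipode should send the matrix of generators to its inverse, and that is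
legitimate because the relations pass to inverse matrices (`Satisfies.inv`). -/

open scoped Kronecker

namespace CoactBialg

/-! ### Coactions as matrices over the coacting algebra -/

section Relations

set_option linter.unusedSectionVars false

variable {k : Type u} {P : Type v} {n : ℕ} [Field k] [NonUnitalCommRing P] [Module k P]
  [IsScalarTower k P P] [SMulCommClass k P P] [PoissonAlgebra k P]
  (b : Module.Basis (Fin n) k P)
  {A A' : Type*} [CommRing A] [Algebra k A] [CommRing A'] [Algebra k A']

/-- The structure constants of `m`, as a matrix over `A`. -/
noncomputable def structureMatrix (A : Type*) [CommRing A] [Algebra k A]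
    (m : P →ₗ[k] P →ₗ[k] P) : Matrix (Fin n) (Fin n × Fin n) A :=
  Matrix.of fun a q => algebraMap k A (b.repr (m (b q.1) (b q.2)) a)

/-- With `m` viewed as a linear map `P ⊗ P → P`, the relations say that it intertwines `d ⊗ₖ d` with
`d`. In this form inverses can be taken without handling indices. -/
theorem satisfies_iff_matrix (m : P →ₗ[k] P →ₗ[k] P) (d : Matrix (Fin n) (Fin n) A) :
    Satisfies b m d ↔
      d * structureMatrix b A m = structureMatrix b A m * (d ⊗ₖ d) := by
  simp only [Satisfies, ← Matrix.ext_iff, Prod.forall, Matrix.mul_apply, structureMatrix,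
    Matrix.of_apply, Fintype.sum_prod_type, Matrix.kroneckerMap_apply, Algebra.smul_def,
    mul_comm (d _ _) (algebraMap k A _)]

/-- Multiply the intertwining identity by `e` on the left and by `e ⊗ₖ e` on the right.
Commutativity of `A` makes `e ⊗ₖ e` inverse to `d ⊗ₖ d`. -/
theorem Satisfies.inv {m : P →ₗ[k] P →ₗ[k] P} {d e : Matrix (Fin n) (Fin n) A}
    (h : Satisfies b m d) (hde : d * e = 1) : Satisfies b m e := by
  have hed : e * d = 1 := mul_eq_one_comm.1 hde
  rw [satisfies_iff_matrix] at h ⊢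
  have hk : (d ⊗ₖ d) * (e ⊗ₖ e) = 1 := by
    rw [← Matrix.mul_kronecker_mul, hde, Matrix.one_kronecker_one]
  calc e * structureMatrix b A m
      = e * (structureMatrix b A m * (d ⊗ₖ d)) * (e ⊗ₖ e) := by
        rw [Matrix.mul_assoc, Matrix.mul_assoc, hk, Matrix.mul_one]
    _ = structureMatrix b A m * (e ⊗ₖ e) := by
        rw [← h, ← Matrix.mul_assoc, hed, Matrix.one_mul]

theorem Satisfies.map {m : P →ₗ[k] P →ₗ[k] P} {d : Fin n → Fin n → A}
    (h : Satisfies b m d) (f : A →ₐ[k] A') : Satisfies b m fun i j => f (d i j) := by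
  intro a i j
  simpa using congrArg f (h a i j)

/-- The linear map `P → P ⊗ A` with `e_i ↦ ∑ s, e_s ⊗ d s i`. -/
noncomputable def ofMatrix (d : Fin n → Fin n → A) : P →ₗ[k] P ⊗[k] A :=
  b.constr k fun i => ∑ s, b s ⊗ₜ[k] d s i

@[simp]
theorem ofMatrix_basis (d : Fin n → Fin n → A) (i : Fin n) :
    ofMatrix b d (b i) = ∑ s, b s ⊗ₜ[k] d s i := by
  simp [ofMatrix]

theorem sum_basis_tmul_injective {c c' : Fin n → A}
    (h : ∑ s, b s ⊗ₜ[k] c s = ∑ s, b s ⊗ₜ[k] c' s) : c = c' := by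
  funext a
  have := congrArg (fun z => TensorProduct.equivFinsuppOfBasisLeft b z a) h
  simpa [TensorProduct.equivFinsuppOfBasisLeft_apply_tmul_apply, Finsupp.single_apply,
    Module.Basis.repr_self] using this

theorem ofMatrix_injective : Function.Injective (ofMatrix b : (Fin n → Fin n → A) → _) := by
  intro d d' h
  funext s i
  have := LinearMap.congr_fun h (b i)
  rw [ofMatrix_basis, ofMatrix_basis] at this
  exact congrFun (sum_basis_tmul_injective b this) s

theorem exists_eq_ofMatrix (ρ : P →ₗ[k] P ⊗[k] A) : ∃ d, ρ = ofMatrix b d := by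
  have (z : P ⊗[k] A) : ∃ c : Fin n → A, z = ∑ s, b s ⊗ₜ[k] c s := by
    refine ⟨TensorProduct.equivFinsuppOfBasisLeft b z, ?_⟩
    conv_lhs => rw [← (TensorProduct.equivFinsuppOfBasisLeft b).symm_apply_apply z]
    rw [TensorProduct.equivFinsuppOfBasisLeft_symm_apply, Finsupp.sum_fintype _ _ (by simp)]
  choose c hc using this
  exact ⟨fun s i => c (ρ (b i)) s, b.ext fun i => by rw [ofMatrix_basis, ← hc]⟩

theorem lTensor_comp_ofMatrix (f : A →ₗ[k] A') (d : Fin n → Fin n → A) :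
    f.lTensor P ∘ₗ ofMatrix b d = ofMatrix b fun s i => f (d s i) :=
  b.ext fun i => by simp

/-- By bilinearity it suffices to test basis vectors, and the relation with index `a` compares the
coefficients of `b a`. An arbitrary `m` covers the product and the bracket at once. -/
theorem satisfies_iff_map₂ (m : P →ₗ[k] P →ₗ[k] P) (d : Fin n → Fin n → A) :
    Satisfies b m d ↔ ∀ x y, ofMatrix b d (m x y) =
      TensorProduct.map₂ m (LinearMap.mul k A) (ofMatrix b d x) (ofMatrix b d y) := by
  have key (i j : Fin n) : ofMatrix b d (m (b i) (b j)) =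
        ∑ a, b a ⊗ₜ[k] ∑ r, b.repr (m (b i) (b j)) r • d a r := by
    conv_lhs => rw [← b.sum_repr (m (b i) (b j))]
    simp_rw [map_sum, map_smul, ofMatrix_basis, TensorProduct.tmul_sum, TensorProduct.tmul_smul,
      Finset.smul_sum]
    exact Finset.sum_comm
  have key' (i j : Fin n) :
      TensorProduct.map₂ m (LinearMap.mul k A) (ofMatrix b d (b i)) (ofMatrix b d (b j)) =
        ∑ a, b a ⊗ₜ[k] ∑ s, ∑ t, b.repr (m (b s) (b t)) a • (d s i * d t j) := by
    simp only [ofMatrix_basis, map_sum, LinearMap.sum_apply, TensorProduct.map₂_apply_tmul,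
      TensorProduct.map_tmul, LinearMap.mul_apply', TensorProduct.tmul_sum]
    rw [Finset.sum_comm]
    conv_rhs => rw [Finset.sum_comm]
    refine Finset.sum_congr rfl fun s _ => ?_
    conv_rhs => rw [Finset.sum_comm]
    refine Finset.sum_congr rfl fun t _ => ?_
    conv_lhs => rw [← b.sum_repr (m (b s) (b t)), TensorProduct.sum_tmul]
    simp_rw [TensorProduct.smul_tmul]
  constructor
  · intro h x y
    have : m.compr₂ (ofMatrix b d) =
        (TensorProduct.map₂ m (LinearMap.mul k A)).compl₁₂ (ofMatrix b d) (ofMatrix b d) := by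
      refine b.ext fun i => b.ext fun j => ?_
      simp only [LinearMap.compr₂_apply, LinearMap.compl₁₂_apply]
      rw [key, key']
      simp_rw [h _ i j]
    exact LinearMap.congr_fun₂ this x y
  · intro h a i j
    have := h (b i) (b j)
    rw [key, key'] at this
    exact congrFun (sum_basis_tmul_injective b this) a

theorem map₂_mul_apply (X Y : P ⊗[k] A) :
    TensorProduct.map₂ (LinearMap.mul k P) (LinearMap.mul k A) X Y = X * Y := by
  induction X with
  | zero => simp
  | add x₁ x₂ h₁ h₂ => rw [map_add, LinearMap.add_apply, h₁, h₂, add_mul]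
  | tmul p a =>
    induction Y with
    | zero => simp
    | add y₁ y₂ h₁ h₂ => rw [map_add, h₁, h₂, mul_add]
    | tmul q c => simp

theorem isPoissonHom_ofMatrix_iff (d : Fin n → Fin n → A) :
    IsPoissonHom (ofMatrix b d) ↔
      Satisfies b (LinearMap.mul k P) d ∧ Satisfies b (PoissonAlgebra.bracket k) d := by
  rw [satisfies_iff_map₂, satisfies_iff_map₂]
  simp only [map₂_mul_apply, LinearMap.mul_apply']
  -- The bracket of `P ⊗ A` is by definition the `map₂` expression, so only the product needed
  -- rewriting.
  exact ⟨fun h => ⟨h.map_mul, h.map_bracket⟩, fun h => ⟨h.1, h.2⟩⟩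

theorem isPoissonCoaction_ofMatrix_iff {H : Type*} [CommRing H] [Bialgebra k H]
    (d : Fin n → Fin n → H) :
    IsPoissonCoaction (ofMatrix b d) ↔
      (Satisfies b (LinearMap.mul k P) d ∧ Satisfies b (PoissonAlgebra.bracket k) d) ∧
      (∀ i j, Coalgebra.comul (R := k) (d i j) = ∑ s, d i s ⊗ₜ[k] d s j) ∧
      ∀ i j, Coalgebra.counit (R := k) (d i j) = if i = j then (1 : k) else 0 := by
  rw [← isPoissonHom_ofMatrix_iff]
  have hΔ : (∀ p : P, TensorProduct.assoc k P H H ((ofMatrix b d).rTensor H (ofMatrix b d p)) =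
        (Coalgebra.comul (R := k) (A := H)).lTensor P (ofMatrix b d p)) ↔
      ∀ i j, Coalgebra.comul (R := k) (d i j) = ∑ s, d i s ⊗ₜ[k] d s j := by
    -- Both sides of coassociativity are of the form `ofMatrix`, over `H ⊗ H`; injectivity of
    -- `ofMatrix` reduces the axiom to an equality of entries.
    have h₁ : (TensorProduct.assoc k P H H).toLinearMap ∘ₗ (ofMatrix b d).rTensor H ∘ₗ
        ofMatrix b d = ofMatrix b fun i j => ∑ s, d i s ⊗ₜ[k] d s j := by
      refine b.ext fun i => ?_
      simp [TensorProduct.sum_tmul, TensorProduct.tmul_sum]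
      exact Finset.sum_comm
    have h₂ := lTensor_comp_ofMatrix b (Coalgebra.comul (R := k) (A := H)) d
    calc _ ↔ ofMatrix b (fun i j => ∑ s, d i s ⊗ₜ[k] d s j) =
          ofMatrix b fun i j => Coalgebra.comul (R := k) (d i j) := by
          rw [← h₁, ← h₂, LinearMap.ext_iff]; rfl
      _ ↔ _ := by
          rw [(ofMatrix_injective b).eq_iff, funext_iff]
          simp only [funext_iff, eq_comm]
  have hε : (∀ p : P, (Coalgebra.counit (R := k) (A := H)).lTensor P (ofMatrix b d p) =
        p ⊗ₜ[k] (1 : k)) ↔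
      ∀ i j, Coalgebra.counit (R := k) (d i j) = if i = j then (1 : k) else 0 := by
    have h₁ : (TensorProduct.mk k P k).flip 1 =
        ofMatrix b fun i j => if i = j then (1 : k) else 0 := by
      refine b.ext fun i => ?_
      simp [TensorProduct.tmul_ite]
    have h₂ := lTensor_comp_ofMatrix b (Coalgebra.counit (R := k) (A := H)) d
    calc _ ↔ ofMatrix b (fun i j => Coalgebra.counit (R := k) (d i j)) =
          ofMatrix b fun i j => if i = j then (1 : k) else 0 := by
          rw [← h₁, ← h₂, LinearMap.ext_iff]; rfl
      _ ↔ _ := by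
          rw [(ofMatrix_injective b).eq_iff, funext_iff]
          simp only [funext_iff]
  rw [← hΔ, ← hε]
  exact ⟨fun h => ⟨h.toIsPoissonHom, h.coassoc, h.counit⟩, fun h => ⟨h.1, h.2.1, h.2.2⟩⟩

end Relations

end CoactBialg

namespace CoactBialg

/-! ### The Hopf algebra obtained by inverting the determinant -/

section Localization

set_option linter.unusedSectionVars false

variable {k : Type u} {P : Type v} {n : ℕ} [Field k] [NonUnitalCommRing P] [Module k P]
  [IsScalarTower k P P] [SMulCommClass k P P] [PoissonAlgebra k P]
  (b : Module.Basis (Fin n) k P)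

/-- The localization of the universal coacting bialgebra at the determinant of the matrix of
generators. -/
def DetLocalization : Type u := Localization.Away (Matrix.det (Matrix.of (gen b)))

namespace DetLocalization

noncomputable instance : CommRing (DetLocalization b) :=
  inferInstanceAs (CommRing (Localization.Away (Matrix.det (Matrix.of (gen b)))))

noncomputable instance : Algebra k (DetLocalization b) :=
  inferInstanceAs (Algebra k (Localization.Away (Matrix.det (Matrix.of (gen b)))))

noncomputable instance : Algebra (CoactBialg b) (DetLocalization b) :=
  inferInstanceAs (Algebra (CoactBialg b) (Localization.Away (Matrix.det (Matrix.of (gen b)))))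

instance : IsScalarTower k (CoactBialg b) (DetLocalization b) :=
  inferInstanceAs (IsScalarTower k (CoactBialg b)
    (Localization.Away (Matrix.det (Matrix.of (gen b)))))

instance : IsLocalization.Away (Matrix.det (Matrix.of (gen b))) (DetLocalization b) :=
  inferInstanceAs (IsLocalization.Away _ (Localization.Away (Matrix.det (Matrix.of (gen b)))))

/-- The localization map. -/
noncomputable def incl : CoactBialg b →ₐ[k] DetLocalization b :=
  IsScalarTower.toAlgHom k (CoactBialg b) (DetLocalization b)

/-- The matrix of generators. -/
noncomputable def genMatrix : Matrix (Fin n) (Fin n) (DetLocalization b) :=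
  (Matrix.of (gen b)).map (incl b)

theorem incl_gen (i j : Fin n) : incl b (gen b i j) = genMatrix b i j := rfl

theorem isUnit_genMatrix : IsUnit (genMatrix b) := by
  rw [Matrix.isUnit_iff_isUnit_det]
  have := IsLocalization.Away.algebraMap_isUnit (S := DetLocalization b)
    (Matrix.det (Matrix.of (gen b)))
  rw [RingHom.map_det] at this
  exact this

theorem satisfies_genMatrix_mul : Satisfies b (LinearMap.mul k P) (genMatrix b) :=
  (satisfies_mul b).map b (incl b)

theorem satisfies_genMatrix_bracket : Satisfies b (PoissonAlgebra.bracket k) (genMatrix b) :=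
  (satisfies_bracket b).map b (incl b)

variable {A : Type*} [CommRing A] [Algebra k A]

theorem algHom_ext {f g : DetLocalization b →ₐ[k] A}
    (h : ∀ i j, f (genMatrix b i j) = g (genMatrix b i j)) : f = g :=
  IsLocalization.algHom_ext (A := CoactBialg b)
    (Submonoid.powers (Matrix.det (Matrix.of (gen b))))
    (CoactBialg.algHom_ext b h)

/-- The algebra map out of the localization given by an invertible matrix satisfying the
relations. -/
noncomputable def lift (d : Matrix (Fin n) (Fin n) A) (h₁ : Satisfies b (LinearMap.mul k P) d)
    (h₂ : Satisfies b (PoissonAlgebra.bracket k) d) (hd : IsUnit d) :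
    DetLocalization b →ₐ[k] A :=
  IsLocalization.liftAlgHom (M := Submonoid.powers (Matrix.det (Matrix.of (gen b))))
    (f := CoactBialg.lift b d h₁ h₂) (by
      rintro ⟨_, m, rfl⟩
      rw [map_pow]
      refine IsUnit.pow m ?_
      rw [AlgHom.map_det]
      convert (Matrix.isUnit_iff_isUnit_det d).1 hd
      ext i j
      exact lift_gen b d h₁ h₂ i j)

@[simp]
theorem lift_genMatrix (d : Matrix (Fin n) (Fin n) A) (h₁ : Satisfies b (LinearMap.mul k P) d)
    (h₂ : Satisfies b (PoissonAlgebra.bracket k) d) (hd : IsUnit d) (i j : Fin n) :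
    lift b d h₁ h₂ hd (genMatrix b i j) = d i j :=
  (IsLocalization.lift_eq _ _).trans (lift_gen b d h₁ h₂ i j)

/-- The matrix of the values of the comultiplication at the generators. -/
noncomputable def comulMatrix :
    Matrix (Fin n) (Fin n) (DetLocalization b ⊗[k] DetLocalization b) :=
  Matrix.of fun i j => ∑ s, genMatrix b i s ⊗ₜ[k] genMatrix b s j

/-- The matrix is the product of the two copies of the invertible generic matrix, one in each tensor
factor. -/
theorem isUnit_comulMatrix : IsUnit (comulMatrix b) := by
  have : comulMatrix b =
      (Algebra.TensorProduct.includeLeft (S := k) (B := DetLocalization b)).mapMatrix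
        (genMatrix b) *
      (Algebra.TensorProduct.includeRight (A := DetLocalization b)).mapMatrix
        (genMatrix b) := by
    ext i j
    simp [comulMatrix, Matrix.mul_apply]
  rw [this]
  exact ((isUnit_genMatrix b).map _).mul ((isUnit_genMatrix b).map _)

theorem satisfies_comulMatrix (m : P →ₗ[k] P →ₗ[k] P) (h : Satisfies b m (gen b)) :
    Satisfies b m (comulMatrix b) := by
  have := (satisfies_comul b m h).map b (Algebra.TensorProduct.map (incl b) (incl b))
  simp only [map_sum, Algebra.TensorProduct.map_tmul, incl_gen] at this
  exact this

theorem satisfies_one (m : P →ₗ[k] P →ₗ[k] P) :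
    Satisfies b m (1 : Matrix (Fin n) (Fin n) k) :=
  satisfies_counit b m

noncomputable instance : Bialgebra k (DetLocalization b) :=
  Bialgebra.ofAlgHom
    (lift b (comulMatrix b) (satisfies_comulMatrix b _ (satisfies_mul b))
      (satisfies_comulMatrix b _ (satisfies_bracket b)) (isUnit_comulMatrix b))
    (lift b (1 : Matrix (Fin n) (Fin n) k) (satisfies_one b _) (satisfies_one b _) isUnit_one)
    (by
      refine algHom_ext b fun s i => ?_
      simp [comulMatrix, TensorProduct.sum_tmul, TensorProduct.tmul_sum]
      exact Finset.sum_comm)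
    (by
      refine algHom_ext b fun s i => ?_
      simp [comulMatrix, Matrix.one_apply, TensorProduct.ite_tmul])
    (by
      refine algHom_ext b fun s i => ?_
      simp [comulMatrix, Matrix.one_apply, TensorProduct.tmul_ite])

theorem comul_genMatrix (i j : Fin n) : Coalgebra.comul (R := k) (genMatrix b i j) =
    ∑ s, genMatrix b i s ⊗ₜ[k] genMatrix b s j :=
  lift_genMatrix b (comulMatrix b) (satisfies_comulMatrix b _ (satisfies_mul b))
    (satisfies_comulMatrix b _ (satisfies_bracket b)) (isUnit_comulMatrix b) i j

theorem counit_genMatrix (i j : Fin n) : Coalgebra.counit (R := k) (genMatrix b i j) =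
    (1 : Matrix (Fin n) (Fin n) k) i j :=
  lift_genMatrix b (1 : Matrix (Fin n) (Fin n) k) (satisfies_one b _) (satisfies_one b _)
    isUnit_one i j

theorem genMatrix_mul_inv : genMatrix b * (genMatrix b)⁻¹ = 1 :=
  Matrix.mul_nonsing_inv _ ((Matrix.isUnit_iff_isUnit_det _).1 (isUnit_genMatrix b))

theorem inv_mul_genMatrix : (genMatrix b)⁻¹ * genMatrix b = 1 :=
  Matrix.nonsing_inv_mul _ ((Matrix.isUnit_iff_isUnit_det _).1 (isUnit_genMatrix b))

/-- The antipode, which maps the matrix of generators to its inverse. -/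
noncomputable def antipodeAlgHom : DetLocalization b →ₐ[k] DetLocalization b :=
  lift b (genMatrix b)⁻¹ ((satisfies_genMatrix_mul b).inv b (genMatrix_mul_inv b))
    ((satisfies_genMatrix_bracket b).inv b (genMatrix_mul_inv b))
    (IsUnit.of_mul_eq_one _ (inv_mul_genMatrix b))

theorem antipodeAlgHom_genMatrix (i j : Fin n) :
    antipodeAlgHom b (genMatrix b i j) = (genMatrix b)⁻¹ i j :=
  lift_genMatrix b _ _ _ _ i j

theorem algebraMap_one_apply {A : Type*} [CommRing A] [Algebra k A] (i j : Fin n) :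
    algebraMap k A ((1 : Matrix (Fin n) (Fin n) k) i j) =
      (1 : Matrix (Fin n) (Fin n) A) i j := by
  rw [Matrix.one_apply, Matrix.one_apply, apply_ite (algebraMap k A), map_one, map_zero]

/-- As the antipode is an algebra map, its axioms need checking only on the generators, where they
are the entries of `g⁻¹ * g = 1` and `g * g⁻¹ = 1` for `g = genMatrix b`. -/
noncomputable instance : HopfAlgebra k (DetLocalization b) :=
  HopfAlgebra.ofAlgHom (antipodeAlgHom b)
    (by
      refine algHom_ext b fun i j => ?_
      have h := congrFun₂ (inv_mul_genMatrix b) i j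
      simp only [Matrix.mul_apply, ← antipodeAlgHom_genMatrix] at h
      simp [comul_genMatrix, counit_genMatrix, Algebra.ofId_apply, algebraMap_one_apply]
      exact (Finset.sum_congr rfl fun s _ => Algebra.TensorProduct.lift_tmul ..).trans h)
    (by
      refine algHom_ext b fun i j => ?_
      have h := congrFun₂ (genMatrix_mul_inv b) i j
      simpa [comul_genMatrix, counit_genMatrix, Algebra.TensorProduct.lift_tmul,
        antipodeAlgHom_genMatrix, Algebra.ofId_apply, algebraMap_one_apply,
        Matrix.mul_apply] using h)

end DetLocalization

/-! ### Coactions as bialgebra maps, and the Hopf envelope -/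

/-- A multiplicative matrix in a bialgebra, with the relations, gives a bialgebra map. -/
theorem exists_bialgHom {H : Type*} [CommRing H] [Bialgebra k H] (d : Fin n → Fin n → H)
    (h : IsPoissonCoaction (ofMatrix b d)) :
    ∃ g : CoactBialg b →ₐc[k] H, ∀ i j, g (gen b i j) = d i j := by
  obtain ⟨⟨h₁, h₂⟩, hΔ, hε⟩ := (isPoissonCoaction_ofMatrix_iff b d).1 h
  refine ⟨BialgHom.ofAlgHom (lift b d h₁ h₂) ?_ ?_, fun i j => lift_gen b d h₁ h₂ i j⟩
  · refine algHom_ext b fun i j => ?_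
    simp [hε, counit_gen]
  · refine algHom_ext b fun i j => ?_
    simp [hΔ, comul_gen]

theorem bialgHom_ext {H : Type*} [CommRing H] [Bialgebra k H] {f g : CoactBialg b →ₐc[k] H}
    (h : ∀ i j, f (gen b i j) = g (gen b i j)) : f = g := by
  have : (f : CoactBialg b →ₐ[k] H) = g := algHom_ext b h
  ext x
  exact DFunLike.congr_fun this x

theorem isPoissonCoaction_map {H : Type*} [CommRing H] [Bialgebra k H]
    (g : CoactBialg b →ₐc[k] H) : IsPoissonCoaction (ofMatrix b fun i j => g (gen b i j)) := by
  refine (isPoissonCoaction_ofMatrix_iff b _).2 ⟨⟨?_, ?_⟩, fun i j => ?_, fun i j => ?_⟩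
  · exact (satisfies_mul b).map b (g : CoactBialg b →ₐ[k] H)
  · exact (satisfies_bracket b).map b (g : CoactBialg b →ₐ[k] H)
  · rw [← CoalgHomClass.map_comp_comul_apply, comul_gen]
    simp
  · rw [CoalgHomClass.counit_comp_apply, counit_gen]

theorem lTensor_comp_coact {H : Type*} [CommRing H] [Bialgebra k H]
    (g : CoactBialg b →ₐc[k] H) :
    (g : CoactBialg b →ₗ[k] H).lTensor P ∘ₗ coact b = ofMatrix b fun i j => g (gen b i j) :=
  lTensor_comp_ofMatrix b (g : CoactBialg b →ₗ[k] H) (gen b)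

/-- Evaluated on a generator, the axiom `x₁ S(x₂) = ε(x)` says that the matrix times its entrywise
antipode is the identity. -/
theorem isUnit_map_gen {H : Type*} [CommRing H] [HopfAlgebra k H]
    (g : CoactBialg b →ₐc[k] H) : IsUnit (Matrix.of fun i j => g (gen b i j)) := by
  refine IsUnit.of_mul_eq_one (Matrix.of fun i j => HopfAlgebra.antipode k (g (gen b i j))) ?_
  ext i j
  have h := HopfAlgebra.mul_antipode_lTensor_comul_apply (R := k) (g (gen b i j))
  rw [← CoalgHomClass.map_comp_comul_apply, comul_gen, CoalgHomClass.counit_comp_apply,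
    counit_gen] at h
  simpa [Matrix.mul_apply, Matrix.one_apply, apply_ite] using h

namespace DetLocalization

/-- The localization map, as a map of bialgebras. -/
noncomputable def inclBialgHom : CoactBialg b →ₐc[k] DetLocalization b :=
  BialgHom.ofAlgHom (incl b)
    (CoactBialg.algHom_ext b fun i j => by
      simp [incl_gen, counit_genMatrix, counit_gen, Matrix.one_apply])
    (CoactBialg.algHom_ext b fun i j => by
      simp [incl_gen, comul_genMatrix, comul_gen])

theorem isCommHopfEnvelope : IsCommHopfEnvelope (inclBialgHom b) := by
  intro A _ _ g
  have h := isPoissonCoaction_map b g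
  obtain ⟨⟨h₁, h₂⟩, hΔ, hε⟩ := (isPoissonCoaction_ofMatrix_iff b _).1 h
  obtain ⟨l, hl⟩ : ∃ l : DetLocalization b →ₐ[k] A, ∀ i j,
      l (genMatrix b i j) = g (gen b i j) :=
    ⟨lift b _ h₁ h₂ (isUnit_map_gen b g), lift_genMatrix b _ h₁ h₂ (isUnit_map_gen b g)⟩
  refine ⟨BialgHom.ofAlgHom l ?_ ?_, bialgHom_ext b hl, fun f hf => ?_⟩
  · refine algHom_ext b fun i j => ?_
    simp [counit_genMatrix, hl, hε, Matrix.one_apply]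
  · refine algHom_ext b fun i j => ?_
    simp [comul_genMatrix, hl, hΔ]
  -- Uniqueness holds already among algebra maps, since a map out of a localization is determined on
  -- the original ring.
  · have : (f : DetLocalization b →ₐ[k] A) = l :=
      algHom_ext b fun i j => (DFunLike.congr_fun hf (gen b i j)).trans (hl i j).symm
    ext x
    exact DFunLike.congr_fun this x

end DetLocalization

/-! ### Initiality of the Hopf envelope -/

theorem isInitial_of_isCommHopfEnvelope {L : Type u} [CommRing L] [HopfAlgebra k L]
    {μ : CoactBialg b →ₐc[k] L} (hμ : IsCommHopfEnvelope μ) :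
    ∃ h : IsPoissonCoaction ((μ : CoactBialg b →ₗ[k] L).lTensor P ∘ₗ coact b),
      Nonempty (CategoryTheory.Limits.IsInitial
        (CoactHopf.mk (carrier := L)
          ((μ : CoactBialg b →ₗ[k] L).lTensor P ∘ₗ coact b) h)) := by
  have h : IsPoissonCoaction ((μ : CoactBialg b →ₗ[k] L).lTensor P ∘ₗ coact b) := by
    rw [lTensor_comp_coact]
    exact isPoissonCoaction_map b μ
  refine ⟨h, ?_⟩
  have key (Y : CoactHopf k P) : ∃! f : L →ₐc[k] Y.carrier,
      (f : L →ₗ[k] Y.carrier).lTensor P ∘ₗ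
        ((μ : CoactBialg b →ₗ[k] L).lTensor P ∘ₗ coact b) = Y.coact := by
    obtain ⟨d, hd⟩ := exists_eq_ofMatrix b Y.coact
    obtain ⟨g, hg⟩ := exists_bialgHom b d (hd ▸ Y.isPoissonCoaction)
    -- Compatibility with the coactions is equality of the matrices `f (μ x_{ij})` and `d`, that is,
    -- agreement of `f ∘ μ` and `g` on generators. The envelope property then applies verbatim.
    have comm (f : L →ₐc[k] Y.carrier) : (f : L →ₗ[k] Y.carrier).lTensor P ∘ₗ
        ((μ : CoactBialg b →ₗ[k] L).lTensor P ∘ₗ coact b) = Y.coact ↔ f.comp μ = g := by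
      rw [lTensor_comp_coact, lTensor_comp_ofMatrix, hd, (ofMatrix_injective b).eq_iff]
      constructor
      · intro e
        exact bialgHom_ext b fun i j => (congrFun₂ e i j).trans (hg i j).symm
      · rintro rfl
        exact funext₂ hg
    simp_rw [comm]
    exact hμ Y.carrier g
  choose f hf huniq using key
  exact ⟨CategoryTheory.Limits.IsInitial.ofUniqueHom (fun Y => ⟨f Y, hf Y⟩)
    fun Y m => CoactHopf.Hom.ext (huniq Y m.toBialgHom m.comm)⟩

end Localization

end CoactBialg

theorem mainTheorem10 {k : Type u} {P : Type v} [Field k] [NonUnitalCommRing P] [Module k P]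
    [IsScalarTower k P P] [SMulCommClass k P P] [PoissonAlgebra k P] [FiniteDimensional k P] :
    -- the category of commutative Hopf algebras coacting on `P` has an initial object
    CategoryTheory.Limits.HasInitial (CoactHopf k P) ∧
    -- it is the commutative Hopf envelope of the universal coacting bialgebra `𝒫(P)`
    ∀ {n : ℕ} (b : Module.Basis (Fin n) k P),
      (∃ (L : CommHopfAlgCat.{u} k) (μ : CoactBialg b →ₐc[k] L), IsCommHopfEnvelope μ) ∧
      ∀ (L : Type u) [CommRing L] [HopfAlgebra k L] (μ : CoactBialg b →ₐc[k] L),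
        IsCommHopfEnvelope μ →
        ∃ h : IsPoissonCoaction
            ((μ : CoactBialg b →ₗ[k] L).lTensor P ∘ₗ CoactBialg.coact b),
          Nonempty (CategoryTheory.Limits.IsInitial
            (CoactHopf.mk (carrier := L)
              ((μ : CoactBialg b →ₗ[k] L).lTensor P ∘ₗ CoactBialg.coact b) h)) := by
  refine ⟨?_, fun {n} b => ⟨⟨.of k (CoactBialg.DetLocalization b),
    CoactBialg.DetLocalization.inclBialgHom b,
    CoactBialg.DetLocalization.isCommHopfEnvelope b⟩, fun L _ _ μ hμ =>
    CoactBialg.isInitial_of_isCommHopfEnvelope b hμ⟩⟩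
  obtain ⟨_, ⟨h⟩⟩ := CoactBialg.isInitial_of_isCommHopfEnvelope (Module.finBasis k P)
    (CoactBialg.DetLocalization.isCommHopfEnvelope (Module.finBasis k P))
  exact h.hasInitial
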